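/- Let $G=(V,E)$ be a connected, simple, undirected, locally finite (possibly infinite) graph, and let $d(\cdot,\cdot)$ be its graph distance and $d_x$ the degree of a vertex $x$. For $p\in[0,1]$ let $\mu_x^p$ be the probability measure on $V$ with $\mu_x^p(x)=p$, $\mu_x^p(y)=\frac{1-p}{d_x}$ if $xy\in E$, and $\mu_x^p(y)=0$ otherwise. Let $$W(\mu_1,\mu_2)=\inf_{\pi}\sum_{x,y\in V}d(x,y)\,\pi(x,y)$$ be the Wasserstein distance, the infimum being over all maps $\pi:V\times V\to[0,1]$ with $\sum_{y}\pi(x,y)=\mu_1(x)$ for all $x$ and $\sum_{x}\pi(x,y)=\mu_2(y)$ for all $y$. The Lin-Lu-Yau curvature of two adjacent vertices $x,y$ is $$\kappa_{LLY}(x,y)=\lim_{p\to1^-}\frac{1}{1-p}\left(1-\frac{W(\mu_x^p,\mu_y^p)}{d(x,y)}\right).$$ Let $\delta(G)=\min_{x\in V}d_x$ be the minimum vertex degree, and let the edge-connectivity $k'(G)$ be the minimum number of edges whose removal disconnects $G$ (with $k'(G)=0$ if $G$ has a single vertex). If $\kappa_{LLY}(x,y)>0$ for every pair of adjacent vertices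 $x,y$ of $G$, then $$k'(G)=\delta(G).$$ -/

import Mathlib

open Filter Topology
open scoped ENNReal

noncomputable section

namespace LLY

variable {V : Type*}

/-- The probability measure `μ_x^p` around a vertex `x` with idleness `p`, as a function on the
vertices: mass `p` at `x` and mass `(1 - p) / d_x` at each neighbour of `x`. -/
def ballMeasure (G : SimpleGraph V) [G.LocallyFinite] (p : ℝ) (x : V) : V → ℝ :=
  open Classical in
  fun y => if y = x then p else if G.Adj x y then (1 - p) / (G.degree x : ℝ) else 0

/-- `π` is a transport plan from `μ₁` to `μ₂`: a map `V × V → [0,1]` with marginals `μ₁`, `μ₂`. -/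
structure IsTransportPlan (μ₁ μ₂ : V → ℝ) (π : V → V → ℝ) : Prop where
  nonneg : ∀ x y, 0 ≤ π x y
  le_one : ∀ x y, π x y ≤ 1
  fst_marginal : ∀ x, HasSum (fun y => π x y) (μ₁ x)
  snd_marginal : ∀ y, HasSum (fun x => π x y) (μ₂ y)

/-- The cost `∑_{x,y} d(x,y) π(x,y) ∈ [0,∞]` of a transport plan on a connected graph. -/
def transportCost (G : SimpleGraph V) (π : V → V → ℝ) : ℝ≥0∞ :=
  ∑' x, ∑' y, ENNReal.ofReal ((G.dist x y : ℝ) * π x y)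

/-- The Wasserstein distance `W(μ₁, μ₂) ∈ [0,∞]` on a connected graph. -/
def wasserstein (G : SimpleGraph V) (μ₁ μ₂ : V → ℝ) : ℝ≥0∞ :=
  ⨅ (π : V → V → ℝ) (_ : IsTransportPlan μ₁ μ₂ π), transportCost G π

/-- The `p`-Ollivier curvature `κ_p(x,y) = 1 - W(μ_x^p, μ_y^p) / d(x,y)`. (The measures have finite
support, so for `p ∈ [0,1]` and non-isolated vertices of a connected graph `W` is finite.) -/
def ollivierCurvature (G : SimpleGraph V) [G.LocallyFinite] (p : ℝ) (x y : V) : ℝ :=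
  1 - (wasserstein G (ballMeasure G p x) (ballMeasure G p y)).toReal / (G.dist x y : ℝ)

/-- The Lin–Lu–Yau curvature `κ_LLY(x,y) = lim_{p → 1} κ_p(x,y) / (1 - p)`, with `p < 1`. -/
def curvature (G : SimpleGraph V) [G.LocallyFinite] (x y : V) : ℝ :=
  limUnder (𝓝[<] (1 : ℝ)) fun p => ollivierCurvature G p x y / (1 - p)

/-- `G` has positive Lin–Lu–Yau curvature: `κ_LLY(x,y) > 0` for all adjacent vertices `x, y`. -/
def HasPositiveCurvature (G : SimpleGraph V) [G.LocallyFinite] : Prop :=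
  ∀ x y, G.Adj x y → 0 < curvature G x y

/-- The minimum vertex degree of a (non-empty, possibly infinite) locally finite graph. -/
def minDegree (G : SimpleGraph V) [G.LocallyFinite] : ℕ :=
  ⨅ v, G.degree v

/-- The edge-connectivity: the minimum number of edges whose removal disconnects the graph, and
`0` for a graph with a single vertex. -/
def edgeConnectivity (G : SimpleGraph V) : ℕ∞ :=
  open Classical in
  if Nontrivial V then
    sInf {n : ℕ∞ | ∃ S : Set (Sym2 V), S ⊆ G.edgeSet ∧ S.encard = n ∧
      ¬ (G.deleteEdges S).Connected}
  else 0

end LLY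

end

namespace LLY

/-! ### Finitely supported transport plans and weak duality -/

section Transport

variable {V : Type*} {G : SimpleGraph V} {μ₁ μ₂ : V → ℝ} {π : V → V → ℝ} {T : Finset V}

/-! Removing the edges at a vertex of least degree disconnects the graph, so only the lower bound
needs curvature. Suppose a smallest finite cut, between `A` and its complement, has `k` edges and
every degree exceeds `k`. Call a vertex exceptional if it has more neighbours across the cut than
inner neighbours, those on its own side and off the boundary. A test function with four levels, fed
into Kantorovich duality, shows that every cut edge has an exceptional end (`add_pos`). Counting cut
edges allows at most one exceptional boundary vertex per side (`eq_of_innerDegree_lt_outDegree`).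

If only one side has one, it meets all cut edges, and moving it across gives a smaller cut
(`outDegree_le_innerDegree_of_forall_fst_eq`). If both sides do, say `x` and `y`, curvature on
another cut edge at each of them (`two_mul_outDegree_ge`) gives two inequalities that together
contradict the edge count. -/

theorem IsTransportPlan.eq_zero_of_left (h : IsTransportPlan μ₁ μ₂ π) {x : V} (hx : μ₁ x = 0)
    (y : V) : π x y = 0 :=
  congrFun ((hasSum_zero_iff_of_nonneg (h.nonneg x)).1 (hx ▸ h.fst_marginal x)) y

theorem IsTransportPlan.eq_zero_of_right (h : IsTransportPlan μ₁ μ₂ π) {y : V} (hy : μ₂ y = 0)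
    (x : V) : π x y = 0 :=
  congrFun ((hasSum_zero_iff_of_nonneg (fun x => h.nonneg x y)).1 (hy ▸ h.snd_marginal y)) x

theorem IsTransportPlan.sum_left (h : IsTransportPlan μ₁ μ₂ π) (h₂ : ∀ v ∉ T, μ₂ v = 0) (x : V) :
    ∑ y ∈ T, π x y = μ₁ x :=
  (hasSum_sum_of_ne_finset_zero fun y hy => h.eq_zero_of_right (h₂ y hy) x).unique
    (h.fst_marginal x)

theorem IsTransportPlan.sum_right (h : IsTransportPlan μ₁ μ₂ π) (h₁ : ∀ v ∉ T, μ₁ v = 0) (y : V) :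
    ∑ x ∈ T, π x y = μ₂ y :=
  (hasSum_sum_of_ne_finset_zero fun x hx => h.eq_zero_of_left (h₁ x hx) y).unique
    (h.snd_marginal y)

/-- The cost of a transport plan between finitely supported measures is a finite sum. -/
theorem IsTransportPlan.transportCost_eq (h : IsTransportPlan μ₁ μ₂ π)
    (h₁ : ∀ v ∉ T, μ₁ v = 0) (h₂ : ∀ v ∉ T, μ₂ v = 0) :
    transportCost G π = ENNReal.ofReal (∑ x ∈ T, ∑ y ∈ T, (G.dist x y : ℝ) * π x y) := by
  have hn : ∀ x y, 0 ≤ (G.dist x y : ℝ) * π x y :=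
    fun x y => mul_nonneg (Nat.cast_nonneg _) (h.nonneg x y)
  rw [transportCost, ENNReal.ofReal_sum_of_nonneg
    fun x _ => Finset.sum_nonneg fun y _ => hn x y, tsum_eq_sum (s := T)]
  · refine Finset.sum_congr rfl fun x _ => ?_
    rw [ENNReal.ofReal_sum_of_nonneg fun y _ => hn x y, tsum_eq_sum (s := T)]
    intro y hy
    simp [h.eq_zero_of_right (h₂ y hy)]
  · intro x hx
    simp [h.eq_zero_of_left (h₁ x hx)]

/-- Weak Kantorovich duality for finitely supported measures. -/
theorem IsTransportPlan.sum_sub_sum_le (h : IsTransportPlan μ₁ μ₂ π)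
    (h₁ : ∀ v ∉ T, μ₁ v = 0) (h₂ : ∀ v ∉ T, μ₂ v = 0) {f : V → ℝ}
    (hf : ∀ x y, f y - f x ≤ G.dist x y) :
    ∑ v ∈ T, f v * μ₂ v - ∑ v ∈ T, f v * μ₁ v ≤ ∑ x ∈ T, ∑ y ∈ T, (G.dist x y : ℝ) * π x y := by
  have e₁ : ∑ v ∈ T, f v * μ₁ v = ∑ x ∈ T, ∑ y ∈ T, f x * π x y :=
    Finset.sum_congr rfl fun x _ => by rw [← Finset.mul_sum, h.sum_left h₂]
  have e₂ : ∑ v ∈ T, f v * μ₂ v = ∑ x ∈ T, ∑ y ∈ T, f y * π x y := by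
    rw [Finset.sum_comm]
    exact Finset.sum_congr rfl fun y _ => by rw [← Finset.mul_sum, h.sum_right h₁]
  rw [e₁, e₂, ← Finset.sum_sub_distrib]
  refine Finset.sum_le_sum fun x _ => ?_
  rw [← Finset.sum_sub_distrib]
  refine Finset.sum_le_sum fun y _ => ?_
  rw [← sub_mul]
  exact mul_le_mul_of_nonneg_right (hf x y) (h.nonneg x y)

theorem IsTransportPlan.prod (p₁ : ∀ v, 0 ≤ μ₁ v) (p₂ : ∀ v, 0 ≤ μ₂ v)
    (s₁ : HasSum μ₁ 1) (s₂ : HasSum μ₂ 1) : IsTransportPlan μ₁ μ₂ fun x y => μ₁ x * μ₂ y where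
  nonneg x y := mul_nonneg (p₁ x) (p₂ y)
  le_one x y := mul_le_one₀ (le_hasSum s₁ x fun z _ => p₁ z) (p₂ y) (le_hasSum s₂ y fun z _ => p₂ z)
  fst_marginal x := by simpa using s₂.mul_left (μ₁ x)
  snd_marginal y := by simpa using s₁.mul_right (μ₂ y)

theorem IsTransportPlan.single [DecidableEq V] (x y : V) :
    IsTransportPlan (Pi.single x (1 : ℝ)) (Pi.single y 1)
      fun u v => (Pi.single x (1 : ℝ) : V → ℝ) u * (Pi.single y (1 : ℝ) : V → ℝ) v :=
  IsTransportPlan.prod (fun v => by by_cases h : v = x <;> simp [h])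
    (fun v => by by_cases h : v = y <;> simp [h])
    (hasSum_pi_single x 1) (hasSum_pi_single y 1)

theorem IsTransportPlan.convexComb {ν₁ ν₂ : V → ℝ} {ρ : V → V → ℝ}
    (h : IsTransportPlan μ₁ μ₂ π) (h' : IsTransportPlan ν₁ ν₂ ρ) {a b : ℝ} (ha : 0 ≤ a)
    (hb : 0 ≤ b) (hab : a + b = 1) :
    IsTransportPlan (fun v => a * μ₁ v + b * ν₁ v) (fun v => a * μ₂ v + b * ν₂ v)
      fun x y => a * π x y + b * ρ x y where
  nonneg x y := add_nonneg (mul_nonneg ha (h.nonneg x y)) (mul_nonneg hb (h'.nonneg x y))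
  le_one x y := by
    have := mul_le_mul_of_nonneg_left (h.le_one x y) ha
    have := mul_le_mul_of_nonneg_left (h'.le_one x y) hb
    linarith
  fst_marginal x := ((h.fst_marginal x).mul_left a).add ((h'.fst_marginal x).mul_left b)
  snd_marginal y := ((h.snd_marginal y).mul_left a).add ((h'.snd_marginal y).mul_left b)

end Transport

/-! ### Curvature as a genuine limit, and its upper bound by test functions -/

section BallMeasure

variable {V : Type*} {G : SimpleGraph V} [G.LocallyFinite] {p q : ℝ} {x y : V}

theorem ballMeasure_nonneg (hp : p ∈ Set.Icc (0 : ℝ) 1) (x v : V) : 0 ≤ ballMeasure G p x v := by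
  have := hp.1
  have := sub_nonneg.2 hp.2
  unfold ballMeasure
  split_ifs <;> positivity

theorem ballMeasure_eq_zero [DecidableEq V] {v : V} (hv : v ∉ insert x (G.neighborFinset x)) :
    ballMeasure G p x v = 0 := by
  simp only [Finset.mem_insert, SimpleGraph.mem_neighborFinset, not_or] at hv
  simp [ballMeasure, hv.1, hv.2]

theorem sum_mul_ballMeasure [DecidableEq V] {T : Finset V}
    (hT : insert x (G.neighborFinset x) ⊆ T) (f : V → ℝ) :
    ∑ v ∈ T, f v * ballMeasure G p x v =
      p * f x + (1 - p) * ((∑ v ∈ G.neighborFinset x, f v) / G.degree x) := by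
  rw [← Finset.sum_subset hT fun v _ hv => by rw [ballMeasure_eq_zero hv, mul_zero],
    Finset.sum_insert (by simp)]
  have e : ∀ v ∈ G.neighborFinset x,
      f v * ballMeasure G p x v = (1 - p) / G.degree x * f v := by
    intro v hv
    rw [SimpleGraph.mem_neighborFinset] at hv
    simp [ballMeasure, hv.ne', hv, mul_comm]
  rw [Finset.sum_congr rfl e, ← Finset.mul_sum]
  simp only [ballMeasure, if_true]
  ring

theorem hasSum_ballMeasure (hx : G.degree x ≠ 0) : HasSum (ballMeasure G p x) 1 := by
  classical
  have h : HasSum (ballMeasure G p x) _ := hasSum_sum_of_ne_finset_zero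
    (s := insert x (G.neighborFinset x)) fun v hv => ballMeasure_eq_zero hv
  have e := sum_mul_ballMeasure (G := G) (p := p) (x := x) subset_rfl fun _ => (1 : ℝ)
  simp only [one_mul, Finset.sum_const, SimpleGraph.card_neighborFinset_eq_degree,
    nsmul_eq_mul, mul_one] at e
  rw [e, div_self (Nat.cast_ne_zero.2 hx)] at h
  simpa using h

theorem ballMeasure_convexComb [DecidableEq V] (a : ℝ) :
    ballMeasure G (a * p + (1 - a)) x =
      fun v => a * ballMeasure G p x v + (1 - a) * (Pi.single x (1 : ℝ) : V → ℝ) v := by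
  funext v
  unfold ballMeasure
  by_cases h : v = x
  · subst h
    simp
  · by_cases h' : G.Adj x v
    · simp only [h, h', if_false, if_true, Pi.single_apply]
      ring
    · simp [h, h']

theorem degree_ne_zero_of_adj (h : G.Adj x y) : G.degree x ≠ 0 :=
  ((G.degree_pos_iff_exists_adj x).2 ⟨y, h⟩).ne'

/-- A finite set that supports the measures around `x` and `y`. -/
def ballSupport [DecidableEq V] (G : SimpleGraph V) [G.LocallyFinite] (x y : V) : Finset V :=
  insert x (G.neighborFinset x) ∪ insert y (G.neighborFinset y)

theorem ballMeasure_left_eq_zero [DecidableEq V] :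
    ∀ v ∉ ballSupport G x y, ballMeasure G p x v = 0 :=
  fun _ hv => ballMeasure_eq_zero fun h => hv (Finset.mem_union_left _ h)

theorem ballMeasure_right_eq_zero [DecidableEq V] :
    ∀ v ∉ ballSupport G x y, ballMeasure G p y v = 0 :=
  fun _ hv => ballMeasure_eq_zero fun h => hv (Finset.mem_union_right _ h)

/-- Finiteness matters because `toReal` sends `⊤` to `0`. The product plan is a witness. -/
theorem wasserstein_ballMeasure_ne_top (hp : p ∈ Set.Icc (0 : ℝ) 1) (h : G.Adj x y) :
    wasserstein G (ballMeasure G p x) (ballMeasure G p y) ≠ ⊤ := by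
  classical
  have hplan := IsTransportPlan.prod (ballMeasure_nonneg hp x) (ballMeasure_nonneg hp y)
    (hasSum_ballMeasure (degree_ne_zero_of_adj h)) (hasSum_ballMeasure (degree_ne_zero_of_adj h.symm))
  refine ne_top_of_le_ne_top ?_ (iInf₂_le _ hplan)
  rw [hplan.transportCost_eq (T := ballSupport G x y) ballMeasure_left_eq_zero
    ballMeasure_right_eq_zero]
  exact ENNReal.ofReal_ne_top

/-- A lower bound for the cost of all plans is a lower bound for the Wasserstein distance. -/
theorem le_toReal_wasserstein [DecidableEq V] (hp : p ∈ Set.Icc (0 : ℝ) 1) (h : G.Adj x y) {c : ℝ}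
    (hc : ∀ π, IsTransportPlan (ballMeasure G p x) (ballMeasure G p y) π →
      c ≤ ∑ u ∈ ballSupport G x y, ∑ v ∈ ballSupport G x y, (G.dist u v : ℝ) * π u v) :
    c ≤ (wasserstein G (ballMeasure G p x) (ballMeasure G p y)).toReal := by
  rw [← ENNReal.ofReal_le_iff_le_toReal (wasserstein_ballMeasure_ne_top hp h)]
  refine le_iInf₂ fun π hπ => ?_
  rw [hπ.transportCost_eq (T := ballSupport G x y) ballMeasure_left_eq_zero
    ballMeasure_right_eq_zero]
  exact ENNReal.ofReal_le_ofReal (hc π hπ)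

/-- Raising the idleness mixes each measure with the Dirac mass at its centre. Mixing plans in the
same way moves the extra mass `1 - a` along the edge, at distance `1`. -/
theorem toReal_wasserstein_convexComb_le {a : ℝ} (hp : p ∈ Set.Icc (0 : ℝ) 1) (h : G.Adj x y)
    (ha : 0 < a) (ha' : a ≤ 1) :
    (wasserstein G (ballMeasure G (a * p + (1 - a)) x)
      (ballMeasure G (a * p + (1 - a)) y)).toReal ≤
    a * (wasserstein G (ballMeasure G p x) (ballMeasure G p y)).toReal + (1 - a) := by
  classical
  set W := (wasserstein G (ballMeasure G (a * p + (1 - a)) x)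
      (ballMeasure G (a * p + (1 - a)) y)).toReal
  suffices (W - (1 - a)) / a ≤ (wasserstein G (ballMeasure G p x) (ballMeasure G p y)).toReal by
    rw [div_le_iff₀ ha] at this
    linarith
  refine le_toReal_wasserstein hp h fun π hπ => ?_
  rw [div_le_iff₀ ha]
  have hρ := hπ.convexComb (IsTransportPlan.single x y) ha.le (sub_nonneg.2 ha') (by ring)
  rw [← ballMeasure_convexComb, ← ballMeasure_convexComb] at hρ
  have hle := iInf₂_le (f := fun (π : V → V → ℝ) (_ : IsTransportPlan
    (ballMeasure G (a * p + (1 - a)) x) (ballMeasure G (a * p + (1 - a)) y) π) =>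
      transportCost G π) _ hρ
  rw [hρ.transportCost_eq (T := ballSupport G x y) ballMeasure_left_eq_zero
    ballMeasure_right_eq_zero] at hle
  have hle' : W ≤ _ := ENNReal.toReal_mono ENNReal.ofReal_ne_top hle
  rw [ENNReal.toReal_ofReal (Finset.sum_nonneg fun u _ => Finset.sum_nonneg fun v _ =>
    mul_nonneg (Nat.cast_nonneg _) (hρ.nonneg u v))] at hle'
  have hxT : x ∈ ballSupport G x y := by simp [ballSupport]
  have hyT : y ∈ ballSupport G x y := by simp [ballSupport]
  have hsingle : ∑ u ∈ ballSupport G x y, ∑ v ∈ ballSupport G x y, (G.dist u v : ℝ) *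
      ((Pi.single x (1 : ℝ) : V → ℝ) u * (Pi.single y (1 : ℝ) : V → ℝ) v) = 1 := by
    rw [Finset.sum_eq_single_of_mem x hxT fun u _ hu => by simp [Pi.single_apply, hu],
      Finset.sum_eq_single_of_mem y hyT fun v _ hv => by simp [hv]]
    simp [SimpleGraph.dist_eq_one_iff_adj.2 h]
  have hsplit : ∑ u ∈ ballSupport G x y, ∑ v ∈ ballSupport G x y, (G.dist u v : ℝ) *
      (a * π u v + (1 - a) *
        ((Pi.single x (1 : ℝ) : V → ℝ) u * (Pi.single y (1 : ℝ) : V → ℝ) v)) =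
      a * ∑ u ∈ ballSupport G x y, ∑ v ∈ ballSupport G x y, (G.dist u v : ℝ) * π u v +
      (1 - a) * ∑ u ∈ ballSupport G x y, ∑ v ∈ ballSupport G x y, (G.dist u v : ℝ) *
        ((Pi.single x (1 : ℝ) : V → ℝ) u * (Pi.single y (1 : ℝ) : V → ℝ) v) := by
    simp only [Finset.mul_sum, ← Finset.sum_add_distrib]
    exact Finset.sum_congr rfl fun u _ => Finset.sum_congr rfl fun v _ => by ring
  rw [hsplit, hsingle] at hle'
  linarith

/-- Monotonicity, together with an upper bound, makes the limit defining the curvature exist. -/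
theorem monotoneOn_ollivierCurvature_div (h : G.Adj x y) :
    MonotoneOn (fun p => ollivierCurvature G p x y / (1 - p)) (Set.Ioo (0 : ℝ) 1) := by
  intro p hp q hq hpq
  have hp1 : 0 < 1 - p := sub_pos.2 hp.2
  have hq1 : 0 < 1 - q := sub_pos.2 hq.2
  -- This weight turns idleness `p` into `q`.
  have key := toReal_wasserstein_convexComb_le (a := (1 - q) / (1 - p))
    (Set.Ioo_subset_Icc_self hp) h (by positivity) ((div_le_one hp1).2 (by linarith))
  have e : (1 - q) / (1 - p) * p + (1 - (1 - q) / (1 - p)) = q := by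
    field_simp
    ring
  rw [e] at key
  simp only [ollivierCurvature, SimpleGraph.dist_eq_one_iff_adj.2 h, Nat.cast_one, div_one]
  rw [div_le_div_iff₀ hp1 hq1]
  have e' : (1 - q) / (1 - p) * (1 - p) = 1 - q := div_mul_cancel₀ _ hp1.ne'
  have := mul_le_mul_of_nonneg_right key hp1.le
  rw [add_mul, mul_right_comm, sub_mul, e'] at this
  linarith

/-- A `1`-Lipschitz function bounds the Lin–Lu–Yau curvature of an edge from above. -/
theorem curvature_le_of_lipschitz (h : G.Adj x y) {f : V → ℝ}
    (hf : ∀ u v, f v - f u ≤ G.dist u v) (hfxy : f y - f x = 1) :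
    curvature G x y ≤ 1 + (∑ v ∈ G.neighborFinset x, f v) / G.degree x -
      (∑ v ∈ G.neighborFinset y, f v) / G.degree y := by
  classical
  set c := 1 + (∑ v ∈ G.neighborFinset x, f v) / (G.degree x : ℝ) -
    (∑ v ∈ G.neighborFinset y, f v) / (G.degree y : ℝ) with hc
  have hbound : ∀ p ∈ Set.Ioo (0 : ℝ) 1, ollivierCurvature G p x y / (1 - p) ≤ c := by
    intro p hp
    have hp1 : 0 < 1 - p := sub_pos.2 hp.2
    have hW := le_toReal_wasserstein (Set.Ioo_subset_Icc_self hp) h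
      fun π hπ => hπ.sum_sub_sum_le (T := ballSupport G x y) ballMeasure_left_eq_zero
        ballMeasure_right_eq_zero hf
    rw [sum_mul_ballMeasure (T := ballSupport G x y) Finset.subset_union_left,
      sum_mul_ballMeasure (T := ballSupport G x y) Finset.subset_union_right] at hW
    rw [div_le_iff₀ hp1, ollivierCurvature, SimpleGraph.dist_eq_one_iff_adj.2 h, Nat.cast_one,
      div_one, hc]
    have : f y = f x + 1 := by linarith
    rw [this] at hW
    linarith
  -- `limUnder` carries information only once convergence is known.
  have hlim := (monotoneOn_ollivierCurvature_div h).tendsto_nhdsWithin_Ioo_left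
    (Set.nonempty_Ioo.2 zero_lt_one) ⟨c, Set.forall_mem_image.2 hbound⟩
  have hmem : Set.Ioo (0 : ℝ) 1 ∈ 𝓝[<] (1 : ℝ) := Ioo_mem_nhdsLT zero_lt_one
  rw [curvature, hlim.limUnder_eq]
  exact le_of_tendsto hlim (Filter.mem_of_superset hmem hbound)

end BallMeasure

/-! ### Lipschitz functions from edgewise bounds -/

section Lipschitz

variable {V : Type*} {G : SimpleGraph V}

theorem sub_le_dist_of_adj (hconn : G.Connected) {f : V → ℝ}
    (hf : ∀ u v, G.Adj u v → f v - f u ≤ 1) (u v : V) : f v - f u ≤ G.dist u v := by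
  obtain ⟨w, hw⟩ := hconn.exists_walk_length_eq_dist u v
  rw [← hw]
  clear hw
  induction w with
  | nil => simp
  | cons h w ih =>
    have := hf _ _ h
    rw [SimpleGraph.Walk.length_cons]
    push_cast
    linarith

end Lipschitz

/-! ### Cuts, their boundaries, and the curvature argument -/

section Cut

variable {V : Type*} (G : SimpleGraph V) (A : Set V)

/-- The edges leaving `A`, oriented from `A` to its complement. -/
def cut : Set (V × V) :=
  {e | e.1 ∈ A ∧ e.2 ∉ A ∧ G.Adj e.1 e.2}

/-- The vertices of `A` with a neighbour outside `A`. -/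
def boundary : Set V :=
  {v | v ∈ A ∧ ∃ w ∉ A, G.Adj v w}

open Classical in
/-- The number of neighbours of `v` outside `A`. -/
noncomputable def outDegree [G.LocallyFinite] (v : V) : ℕ :=
  ((G.neighborFinset v).filter (· ∉ A)).card

open Classical in
/-- The number of neighbours of `v` in the boundary of `A`. -/
noncomputable def boundaryDegree [G.LocallyFinite] (v : V) : ℕ :=
  ((G.neighborFinset v).filter (· ∈ boundary G A)).card

open Classical in
/-- The number of neighbours of `v` in `A` outside its boundary. -/
noncomputable def innerDegree [G.LocallyFinite] (v : V) : ℕ :=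
  ((G.neighborFinset v).filter fun w => w ∈ A ∧ w ∉ boundary G A).card

variable {G A}

theorem boundary_eq_image_cut : boundary G A = Prod.fst '' cut G A := by
  ext v
  simp [boundary, cut]

theorem boundary_finite (hfin : (cut G A).Finite) : (boundary G A).Finite :=
  boundary_eq_image_cut ▸ hfin.image _

theorem cut_compl : cut G Aᶜ = Prod.swap '' cut G A := by
  ext ⟨x, y⟩
  simp only [cut, Set.mem_ofPred_eq, Set.mem_compl_iff, not_not, Set.mem_image, Prod.exists,
    Prod.swap_prod_mk, Prod.mk.injEq]
  constructor
  · rintro ⟨hx, hy, h⟩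
    exact ⟨y, x, ⟨hy, hx, h.symm⟩, rfl, rfl⟩
  · rintro ⟨_, _, ⟨hy, hx, h⟩, rfl, rfl⟩
    exact ⟨hx, hy, h.symm⟩

theorem ncard_cut_compl : (cut G Aᶜ).ncard = (cut G A).ncard := by
  rw [cut_compl, Set.ncard_image_of_injective _ Prod.swap_injective]

theorem cut_nonempty (hconn : G.Connected) (hA : A.Nonempty) (hA' : Aᶜ.Nonempty) :
    (cut G A).Nonempty := by
  obtain ⟨u, hu⟩ := hA
  obtain ⟨v, hv⟩ := hA'
  obtain ⟨w⟩ := hconn.preconnected u v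
  obtain ⟨d, -, hd, hd'⟩ := w.exists_boundary_dart A hu hv
  exact ⟨(d.fst, d.snd), hd, hd', d.adj⟩

variable [G.LocallyFinite] {x y : V}

theorem degree_eq_add_add (A : Set V) (v : V) :
    G.degree v = outDegree G A v + boundaryDegree G A v + innerDegree G A v := by
  classical
  rw [outDegree, boundaryDegree, innerDegree, ← SimpleGraph.card_neighborFinset_eq_degree,
    ← Finset.card_filter_add_card_filter_not (s := G.neighborFinset v) (· ∉ A), add_assoc,
    ← Finset.card_filter_add_card_filter_not
      (s := (G.neighborFinset v).filter (¬ · ∉ A)) (· ∈ boundary G A)]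
  simp only [Finset.filter_filter, not_not]
  congr 3
  ext w
  simp only [Finset.mem_filter, and_congr_right_iff, and_iff_right_iff_imp]
  exact fun _ hw => hw.1

theorem one_le_outDegree (hx : x ∈ boundary G A) : 1 ≤ outDegree G A x := by
  obtain ⟨-, w, hw, h⟩ := hx
  exact Finset.card_pos.2 ⟨w, by simpa [hw] using h⟩

theorem boundaryDegree_add_one_le (hfin : (cut G A).Finite) (hx : x ∈ boundary G A) :
    boundaryDegree G A x + 1 ≤ (boundary G A).ncard := by
  classical
  rw [Set.ncard_eq_toFinset_card _ (boundary_finite hfin),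
    ← Finset.card_erase_add_one ((boundary_finite hfin).mem_toFinset.2 hx)]
  refine Nat.add_le_add_right (Finset.card_le_card fun w hw => ?_) 1
  simp only [Finset.mem_filter, SimpleGraph.mem_neighborFinset] at hw
  simp [hw.1.ne', hw.2]

theorem ncard_cut_eq_sum (hfin : (cut G A).Finite) :
    (cut G A).ncard = ∑ v ∈ (boundary_finite hfin).toFinset, outDegree G A v := by
  classical
  rw [Set.ncard_eq_toFinset_card _ hfin, Finset.card_eq_sum_card_fiberwise (f := Prod.fst)
    (t := (boundary_finite hfin).toFinset)]
  · refine Finset.sum_congr rfl fun v hv => ?_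
    have hvA : v ∈ A := ((boundary_finite hfin).mem_toFinset.1 hv).1
    refine Finset.card_bij' (fun e _ => e.2) (fun w _ => (v, w)) ?_ ?_ ?_ ?_
    · rintro ⟨a, b⟩ h
      simp only [Finset.mem_filter, Set.Finite.mem_toFinset, cut, Set.mem_ofPred_eq] at h
      obtain ⟨⟨-, hb, hab⟩, rfl⟩ := h
      simp [hb, hab]
    · intro w hw
      simp only [Finset.mem_filter, SimpleGraph.mem_neighborFinset] at hw
      simp [cut, hvA, hw.1, hw.2]
    · rintro ⟨a, b⟩ h
      simp only [Finset.mem_filter] at h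
      simp [h.2]
    · simp
  · rintro e he
    rw [Finset.mem_coe, Set.Finite.mem_toFinset] at he ⊢
    rw [boundary_eq_image_cut]
    exact Set.mem_image_of_mem _ he

/-- Each boundary vertex outside `s` still accounts for at least one cut edge. -/
theorem sum_outDegree_add_ncard_boundary_le (hfin : (cut G A).Finite) {s : Finset V}
    (hs : ∀ v ∈ s, v ∈ boundary G A) :
    ∑ v ∈ s, outDegree G A v + (boundary G A).ncard ≤ (cut G A).ncard + s.card := by
  classical
  have hsub : s ⊆ (boundary_finite hfin).toFinset :=
    fun v hv => (boundary_finite hfin).mem_toFinset.2 (hs v hv)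
  rw [ncard_cut_eq_sum hfin, ← Finset.sum_sdiff hsub,
    Set.ncard_eq_toFinset_card _ (boundary_finite hfin), ← Finset.card_sdiff_add_card_eq_card hsub]
  have : ((boundary_finite hfin).toFinset \ s).card ≤
      ∑ v ∈ (boundary_finite hfin).toFinset \ s, outDegree G A v := by
    rw [Finset.card_eq_sum_ones]
    exact Finset.sum_le_sum fun v hv => one_le_outDegree
      ((boundary_finite hfin).mem_toFinset.1 (Finset.mem_sdiff.1 hv).1)
  omega

theorem outDegree_add_ncard_boundary_le (hfin : (cut G A).Finite) (hx : x ∈ boundary G A) :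
    outDegree G A x + (boundary G A).ncard ≤ (cut G A).ncard + 1 := by
  simpa using sum_outDegree_add_ncard_boundary_le hfin (s := {x}) (by simpa using hx)

/-- In positive curvature, the two ends of a cut edge cannot both have at least as many inner
neighbours as neighbours across the cut. -/
theorem HasPositiveCurvature.add_pos (hpos : HasPositiveCurvature G) (hconn : G.Connected)
    (hx : x ∈ A) (hy : y ∉ A) (h : G.Adj x y) :
    0 < ((outDegree G A x : ℝ) - innerDegree G A x) / G.degree x +
      ((outDegree G Aᶜ y : ℝ) - innerDegree G Aᶜ y) / G.degree y := by
  classical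
  -- The levels `-1, 0, 1, 2` run from the interior of `A` through both boundaries to the interior
  -- of the complement. Cut edges join only levels `0` and `1`, so `f` is Lipschitz.
  set f : V → ℝ := fun v =>
    if v ∈ A then if v ∈ boundary G A then 0 else -1
    else if v ∈ boundary G Aᶜ then 1 else 2 with hf
  have hcross : ∀ u v, u ∈ A → v ∉ A → G.Adj u v → f u = 0 ∧ f v = 1 := by
    intro u v hu hv huv
    have h₁ : u ∈ boundary G A := ⟨hu, v, hv, huv⟩
    have h₂ : v ∈ boundary G Aᶜ := ⟨hv, u, not_not.2 hu, huv.symm⟩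
    simp [hf, hu, hv, h₁, h₂]
  have hlip : ∀ u v, G.Adj u v → f v - f u ≤ 1 := by
    intro u v huv
    by_cases hu : u ∈ A <;> by_cases hv : v ∈ A
    · simp only [hf, hu, hv, if_true]
      split_ifs <;> norm_num
    · rw [(hcross u v hu hv huv).1, (hcross u v hu hv huv).2]
      norm_num
    · rw [(hcross v u hv hu huv.symm).1, (hcross v u hv hu huv.symm).2]
      norm_num
    · simp only [hf, hu, hv, if_false]
      split_ifs <;> norm_num
  have hsx : ∑ v ∈ G.neighborFinset x, f v = (outDegree G A x : ℝ) - innerDegree G A x := by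
    rw [outDegree, innerDegree, ← Finset.sum_boole, ← Finset.sum_boole, ← Finset.sum_sub_distrib]
    refine Finset.sum_congr rfl fun v hv => ?_
    rw [SimpleGraph.mem_neighborFinset] at hv
    by_cases hvA : v ∈ A
    · by_cases hvb : v ∈ boundary G A <;> simp [hf, hvA, hvb]
    · simp [(hcross x v hx hvA hv).2, hvA]
  have hsy : ∑ v ∈ G.neighborFinset y, f v =
      G.degree y - ((outDegree G Aᶜ y : ℝ) - innerDegree G Aᶜ y) := by
    rw [outDegree, innerDegree, ← Finset.sum_boole, ← Finset.sum_boole,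
      ← SimpleGraph.card_neighborFinset_eq_degree, Finset.cast_card, ← Finset.sum_sub_distrib,
      ← Finset.sum_sub_distrib]
    refine Finset.sum_congr rfl fun v hv => ?_
    rw [SimpleGraph.mem_neighborFinset] at hv
    by_cases hvA : v ∈ A
    · simp [(hcross v y hvA hy hv.symm).1, hvA]
    · by_cases hvb : v ∈ boundary G Aᶜ
      · simp [hf, hvA, hvb]
      · simp only [hf, hvA, hvb, if_false, Set.mem_compl_iff, not_false_eq_true, not_true, and_self,
          if_true]
        norm_num
  have hc := (hpos x y h).trans_le (curvature_le_of_lipschitz h (sub_le_dist_of_adj hconn hlip)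
    (by rw [(hcross x y hx hy h).1, (hcross x y hx hy h).2, sub_zero]))
  have hdy : (G.degree y : ℝ) ≠ 0 := Nat.cast_ne_zero.2 (degree_ne_zero_of_adj h.symm)
  rw [hsx, hsy, sub_div (G.degree y : ℝ), div_self hdy] at hc
  linarith

/-- With `k` cut edges and `b` boundary vertices, each exceptional vertex has `k + 3 ≤ 2 * out + b`.
Two of them give `k + 3 ≤ out + out' + b`, but the edge count allows only `k + 2`. -/
theorem eq_of_innerDegree_lt_outDegree (hfin : (cut G A).Finite)
    (hdeg : ∀ v, (cut G A).ncard < G.degree v) {x x' : V} (hx : x ∈ boundary G A)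
    (hx' : x' ∈ boundary G A) (h : innerDegree G A x < outDegree G A x)
    (h' : innerDegree G A x' < outDegree G A x') : x = x' := by
  classical
  by_contra hne
  have h₁ := sum_outDegree_add_ncard_boundary_le hfin (s := {x, x'}) (by simp [hx, hx'])
  rw [Finset.sum_pair hne, Finset.card_pair hne] at h₁
  have := boundaryDegree_add_one_le hfin hx
  have := boundaryDegree_add_one_le hfin hx'
  have := hdeg x
  have := hdeg x'
  have := degree_eq_add_add (G := G) A x
  have := degree_eq_add_add (G := G) A x'
  omega

/-- If all edges of a cut start at one vertex, moving that vertex to the other side gives a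
smaller cut. -/
theorem outDegree_le_innerDegree_of_forall_fst_eq (hfin : (cut G A).Finite)
    (hdeg : (cut G A).ncard < G.degree x)
    (hmin : ∀ B : Set V, B.Nonempty → Bᶜ.Nonempty → (cut G B).Finite →
      (cut G A).ncard ≤ (cut G B).ncard)
    (hx : x ∈ boundary G A) (hall : ∀ e ∈ cut G A, e.1 = x) :
    outDegree G A x ≤ innerDegree G A x := by
  classical
  have hb : boundary G A = {x} := by
    refine Set.eq_singleton_iff_unique_mem.2 ⟨hx, fun v hv => ?_⟩
    rw [boundary_eq_image_cut] at hv
    obtain ⟨e, he, rfl⟩ := hv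
    exact hall e he
  have h₁ := outDegree_add_ncard_boundary_le hfin hx
  have h₂ := boundaryDegree_add_one_le hfin hx
  rw [hb, Set.ncard_singleton] at h₁ h₂
  have h₃ := degree_eq_add_add (G := G) A x
  have hsub : cut G (A \ {x}) ⊆ (fun w => (w, x)) ''
      ((G.neighborFinset x).filter fun w => w ∈ A ∧ w ∉ boundary G A : Finset V) := by
    rintro ⟨u, v⟩ ⟨⟨hu, hux⟩, hv, huv⟩
    rw [Set.mem_singleton_iff] at hux
    obtain rfl : v = x := by
      by_contra hvx
      exact hux (hall (u, v) ⟨hu, fun hvA => hv ⟨hvA, hvx⟩, huv⟩)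
    refine ⟨u, ?_, rfl⟩
    simp only [Finset.coe_filter, Set.mem_ofPred_eq, SimpleGraph.mem_neighborFinset, hb,
      Set.mem_singleton_iff]
    exact ⟨huv.symm, hu, hux⟩
  have hcard : (cut G (A \ {x})).ncard ≤ innerDegree G A x := by
    refine (Set.ncard_le_ncard hsub ((Finset.finite_toSet _).image _)).trans
      ((Set.ncard_image_le (Finset.finite_toSet _)).trans ?_)
    rw [Set.ncard_coe_finset, innerDegree]
  -- The degree exceeds the cut size, so `x` has an inner neighbour. Hence `A \ {x}` is nonempty and
  -- competes in `hmin`.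
  obtain ⟨w, hw⟩ : ((G.neighborFinset x).filter fun w => w ∈ A ∧ w ∉ boundary G A).Nonempty := by
    rw [← Finset.card_pos]
    change 0 < innerDegree G A x
    omega
  simp only [Finset.mem_filter, SimpleGraph.mem_neighborFinset] at hw
  have := hmin (A \ {x}) ⟨w, hw.2.1, hw.1.ne'⟩ ⟨x, fun h => h.2 rfl⟩
    (((Finset.finite_toSet _).image _).subset hsub)
  omega

/-- The gain comes from a cut edge `xz` with `z ≠ y`: `x` is then the only neighbour of `z` across
the cut, so `z` has many inner neighbours and its term in `add_pos` is small. -/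
theorem HasPositiveCurvature.two_mul_outDegree_ge (hpos : HasPositiveCurvature G)
    (hconn : G.Connected) (hfin : (cut G A).Finite) (hdeg : ∀ v, (cut G A).ncard < G.degree v)
    (hx : x ∈ boundary G A) (hxlt : innerDegree G A x < outDegree G A x)
    (hall : ∀ e ∈ cut G A, e.1 = x ∨ e.2 = y) :
    2 * (cut G A).ncard + 3 ≤
      2 * outDegree G A x + (boundary G A).ncard + (boundary G Aᶜ).ncard := by
  classical
  have hfin' : (cut G Aᶜ).Finite := cut_compl ▸ hfin.image _
  have h₁ := outDegree_add_ncard_boundary_le hfin hx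
  have h₂ := boundaryDegree_add_one_le hfin hx
  have h₃ := degree_eq_add_add (G := G) A x
  have hdx := hdeg x
  have hout : 1 < outDegree G A x := by omega
  obtain ⟨z, hz, hzy⟩ := Finset.exists_mem_ne hout y
  simp only [Finset.mem_filter, SimpleGraph.mem_neighborFinset] at hz
  obtain ⟨hxz, hzA⟩ := hz
  have hzb : z ∈ boundary G Aᶜ := ⟨hzA, x, not_not.2 hx.1, hxz.symm⟩
  have h₄ : outDegree G Aᶜ z ≤ 1 := by
    rw [← Finset.card_singleton x]
    refine Finset.card_le_card fun w hw => ?_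
    simp only [Finset.mem_filter, SimpleGraph.mem_neighborFinset, Set.mem_compl_iff,
      not_not] at hw
    rw [Finset.mem_singleton]
    exact (hall (w, z) ⟨hw.2, hzA, hw.1.symm⟩).resolve_right hzy
  have h₅ := boundaryDegree_add_one_le hfin' hzb
  have h₆ := degree_eq_add_add (G := G) Aᶜ z
  have hdz := hdeg z
  have key := hpos.add_pos hconn hx.1 hzA hxz
  set k := (cut G A).ncard
  set s := (boundary G Aᶜ).ncard
  have hk : (0 : ℝ) < k + 1 := by positivity
  have hdx' : (k : ℝ) + 1 ≤ G.degree x := by exact_mod_cast hdx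
  have hdz' : (k : ℝ) + 1 ≤ G.degree z := by exact_mod_cast hdz
  have e₁ : ((outDegree G A x : ℝ) - innerDegree G A x) / G.degree x ≤
      ((outDegree G A x : ℝ) - innerDegree G A x) / (k + 1) :=
    div_le_div_of_nonneg_left (sub_nonneg.2 (by exact_mod_cast hxlt.le)) hk hdx'
  have e₂ : ((outDegree G Aᶜ z : ℝ) - innerDegree G Aᶜ z) / G.degree z ≤
      (s + 1) / (k + 1) - 1 := by
    have hle : (outDegree G Aᶜ z : ℝ) - innerDegree G Aᶜ z ≤ s + 1 - G.degree z := by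
      have : outDegree G Aᶜ z + G.degree z ≤ s + 1 + innerDegree G Aᶜ z := by omega
      have : (outDegree G Aᶜ z : ℝ) + G.degree z ≤ s + 1 + innerDegree G Aᶜ z := by
        exact_mod_cast this
      linarith
    have hz0 : (0 : ℝ) < G.degree z := hk.trans_le hdz'
    calc _ ≤ (s + 1 - (G.degree z : ℝ)) / G.degree z := div_le_div_of_nonneg_right hle hz0.le
      _ = (s + 1) / (G.degree z : ℝ) - 1 := by rw [sub_div, div_self hz0.ne']
      _ ≤ _ := sub_le_sub_right (div_le_div_of_nonneg_left (by positivity) hk hdz') 1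
  -- Both degrees are replaced by their lower bound `k + 1`, a common denominator.
  have e₃ : (0 : ℝ) < ((outDegree G A x : ℝ) - innerDegree G A x + (s + 1)) / (k + 1) - 1 := by
    rw [add_div]
    linarith
  rw [sub_pos, one_lt_div hk] at e₃
  have e₄ : k + innerDegree G A x < outDegree G A x + s := by
    have : (k : ℝ) + innerDegree G A x < outDegree G A x + s := by linarith
    exact_mod_cast this
  omega

/-- In positive curvature, a finite cut of minimal size has at least as many edges as some vertex
degree. -/
theorem HasPositiveCurvature.exists_degree_le (hpos : HasPositiveCurvature G)
    (hconn : G.Connected) (hA : A.Nonempty) (hA' : Aᶜ.Nonempty) (hfin : (cut G A).Finite)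
    (hmin : ∀ B : Set V, B.Nonempty → Bᶜ.Nonempty → (cut G B).Finite →
      (cut G A).ncard ≤ (cut G B).ncard) :
    ∃ v, G.degree v ≤ (cut G A).ncard := by
  by_contra! hdeg
  have hfin' : (cut G Aᶜ).Finite := cut_compl ▸ hfin.image _
  have hdeg' : ∀ v, (cut G Aᶜ).ncard < G.degree v := by rwa [ncard_cut_compl]
  have hmin' : ∀ B : Set V, B.Nonempty → Bᶜ.Nonempty → (cut G B).Finite →
      (cut G Aᶜ).ncard ≤ (cut G B).ncard := by rwa [ncard_cut_compl]
  have hl : ∀ e ∈ cut G A, e.1 ∈ boundary G A := fun e he => ⟨he.1, e.2, he.2.1, he.2.2⟩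
  have hr : ∀ e ∈ cut G A, e.2 ∈ boundary G Aᶜ :=
    fun e he => ⟨he.2.1, e.1, not_not.2 he.1, he.2.2.symm⟩
  have hswap : ∀ e ∈ cut G Aᶜ, e.swap ∈ cut G A := by
    rw [cut_compl]
    rintro _ ⟨e, he, rfl⟩
    exact he
  have hor : ∀ e ∈ cut G A, innerDegree G A e.1 < outDegree G A e.1 ∨
      innerDegree G Aᶜ e.2 < outDegree G Aᶜ e.2 := by
    intro e he
    by_contra! hne
    have key := hpos.add_pos hconn he.1 he.2.1 he.2.2
    have h₁ : ((outDegree G A e.1 : ℝ) - innerDegree G A e.1) / G.degree e.1 ≤ 0 :=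
      div_nonpos_of_nonpos_of_nonneg (sub_nonpos.2 (by exact_mod_cast hne.1)) (Nat.cast_nonneg _)
    have h₂ : ((outDegree G Aᶜ e.2 : ℝ) - innerDegree G Aᶜ e.2) / G.degree e.2 ≤ 0 :=
      div_nonpos_of_nonpos_of_nonneg (sub_nonpos.2 (by exact_mod_cast hne.2)) (Nat.cast_nonneg _)
    linarith
  have hP : ∀ x ∈ boundary G A, innerDegree G A x < outDegree G A x →
      ∀ e ∈ cut G A, e.1 = x ∨ innerDegree G Aᶜ e.2 < outDegree G Aᶜ e.2 := fun x hx hxlt e he =>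
    (hor e he).imp_left fun h => eq_of_innerDegree_lt_outDegree hfin hdeg (hl e he) hx h hxlt
  have hQ : ∀ y ∈ boundary G Aᶜ, innerDegree G Aᶜ y < outDegree G Aᶜ y →
      ∀ e ∈ cut G A, innerDegree G A e.1 < outDegree G A e.1 ∨ e.2 = y := fun y hy hylt e he =>
    (hor e he).imp_right fun h => eq_of_innerDegree_lt_outDegree hfin' hdeg' (hr e he) hy h hylt
  by_cases hx : ∃ x ∈ boundary G A, innerDegree G A x < outDegree G A x
  · obtain ⟨x, hx, hxlt⟩ := hx
    by_cases hy : ∃ y ∈ boundary G Aᶜ, innerDegree G Aᶜ y < outDegree G Aᶜ y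
    · obtain ⟨y, hy, hylt⟩ := hy
      have hall : ∀ e ∈ cut G A, e.1 = x ∨ e.2 = y := fun e he => (hP x hx hxlt e he).imp_right
        fun h => eq_of_innerDegree_lt_outDegree hfin' hdeg' (hr e he) hy h hylt
      have h₁ := hpos.two_mul_outDegree_ge hconn hfin hdeg hx hxlt hall
      have h₂ := hpos.two_mul_outDegree_ge hconn hfin' hdeg' hy hylt
        fun e he => (hall _ (hswap e he)).symm
      have h₃ := outDegree_add_ncard_boundary_le hfin hx
      have h₄ := outDegree_add_ncard_boundary_le hfin' hy
      rw [compl_compl] at h₂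
      rw [ncard_cut_compl] at h₂ h₄
      -- With `k` cut edges, `h₁` and `h₂` force a total of at least `4k + 6`, while `h₃` and `h₄`
      -- cap it at `4k + 4`.
      omega
    · push Not at hy
      exact hxlt.not_ge (outDegree_le_innerDegree_of_forall_fst_eq hfin (hdeg x) hmin hx
        fun e he => (hP x hx hxlt e he).resolve_right (hy _ (hr e he)).not_gt)
  · push Not at hx
    obtain ⟨e, he⟩ := cut_nonempty hconn hA hA'
    have hylt := (hor e he).resolve_left (hx _ (hl e he)).not_gt
    exact hylt.not_ge (outDegree_le_innerDegree_of_forall_fst_eq hfin' (hdeg' _) hmin' (hr e he)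
      fun e' he' => (hQ _ (hr e he) hylt _ (hswap e' he')).resolve_left
        (hx _ (hl _ (hswap e' he'))).not_gt)

theorem HasPositiveCurvature.minDegree_le_ncard_cut (hpos : HasPositiveCurvature G)
    (hconn : G.Connected) (hA : A.Nonempty) (hA' : Aᶜ.Nonempty) (hfin : (cut G A).Finite) :
    minDegree G ≤ (cut G A).ncard := by
  -- Finiteness belongs to the minimized predicate, since `ncard` of an infinite cut is `0`.
  obtain ⟨B, ⟨hB, hB', hBfin⟩, hBmin⟩ := exists_minimalFor_of_wellFoundedLT
    (fun B : Set V => B.Nonempty ∧ Bᶜ.Nonempty ∧ (cut G B).Finite) (fun B => (cut G B).ncard)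
    ⟨A, hA, hA', hfin⟩
  have hmin : ∀ C : Set V, C.Nonempty → Cᶜ.Nonempty → (cut G C).Finite →
      (cut G B).ncard ≤ (cut G C).ncard := fun C h h' hC =>
    (le_total (cut G B).ncard (cut G C).ncard).elim id (hBmin ⟨h, h', hC⟩)
  obtain ⟨v, hv⟩ := hpos.exists_degree_le hconn hB hB' hBfin hmin
  exact ((ciInf_le (OrderBot.bddBelow _) v).trans hv).trans (hmin A hA hA' hfin)

end Cut

/-! ### From disconnecting edge sets to cuts and back -/

section EdgeConnectivity

variable {V : Type*} {G : SimpleGraph V}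

/-- A set of edges whose removal disconnects the graph contains the edges of a cut. -/
theorem exists_cut_of_not_connected_deleteEdges [Nonempty V] {S : Set (Sym2 V)}
    (hS : ¬ (G.deleteEdges S).Connected) :
    ∃ A : Set V, A.Nonempty ∧ Aᶜ.Nonempty ∧ (cut G A).encard ≤ S.encard := by
  rw [SimpleGraph.connected_iff] at hS
  simp only [‹Nonempty V›, and_true, SimpleGraph.Preconnected, not_forall] at hS
  obtain ⟨u, w, huw⟩ := hS
  refine ⟨{v | (G.deleteEdges S).Reachable u v}, ⟨u, .refl u⟩, ⟨w, huw⟩, ?_⟩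
  rw [← Set.InjOn.encard_image (f := fun e : V × V => s(e.1, e.2))]
  · refine Set.encard_le_encard ?_
    rintro _ ⟨e, ⟨h₁, h₂, h₃⟩, rfl⟩
    by_contra hne
    exact h₂ (h₁.trans (SimpleGraph.Adj.reachable (SimpleGraph.deleteEdges_adj.2 ⟨h₃, hne⟩)))
  -- An unordered cut edge has only one orientation leaving the component.
  · rintro ⟨a, b⟩ ⟨ha, hb, -⟩ ⟨c, d⟩ ⟨hc, hd, -⟩ h
    rcases Sym2.eq_iff.1 h with ⟨rfl, rfl⟩ | ⟨rfl, rfl⟩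
    · rfl
    · exact absurd ha hd

theorem not_connected_deleteEdges_incidenceSet [Nontrivial V] (v : V) :
    ¬ (G.deleteEdges (G.incidenceSet v)).Connected := by
  intro h
  obtain ⟨w, hw⟩ := h.preconnected.exists_adj_of_nontrivial v
  rw [SimpleGraph.deleteEdges_adj] at hw
  exact hw.2 ⟨hw.1, Sym2.mem_mk_left v w⟩

end EdgeConnectivity

end LLY

theorem mainTheorem1 {V : Type*} (G : SimpleGraph V) [G.LocallyFinite]
    (hconn : G.Connected) (hpos : LLY.HasPositiveCurvature G) :
    LLY.edgeConnectivity G = (LLY.minDegree G : ℕ∞) := by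
  classical
  have := hconn.nonempty
  obtain ⟨v, hv⟩ : ∃ v, G.degree v = ⨅ v, G.degree v := ciInf_mem fun v => G.degree v
  unfold LLY.edgeConnectivity
  split_ifs with hV
  · refine le_antisymm (sInf_le ⟨G.incidenceSet v, G.incidenceSet_subset v, ?_,
      LLY.not_connected_deleteEdges_incidenceSet v⟩) (le_sInf ?_)
    · rw [LLY.minDegree, ← hv, ← SimpleGraph.card_incidenceSet_eq_degree,
        Set.encard_eq_coe_toFinset_card, Set.toFinset_card]
    · rintro _ ⟨S, -, rfl, hS⟩
      obtain ⟨A, hA, hA', hle⟩ := LLY.exists_cut_of_not_connected_deleteEdges hS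
      refine le_trans ?_ hle
      by_cases hfin : (LLY.cut G A).Finite
      · rw [← hfin.cast_ncard_eq]
        exact_mod_cast hpos.minDegree_le_ncard_cut hconn hA hA' hfin
      · rw [Set.not_finite.1 hfin |>.encard_eq]
        exact le_top
  -- A single vertex has degree `0`, matching the convention.
  · rw [not_nontrivial_iff_subsingleton] at hV
    rw [LLY.minDegree, ← hv, eq_comm, Nat.cast_eq_zero, ← Nat.le_zero, ← not_lt,
      G.degree_pos_iff_exists_adj]
    rintro ⟨w, hw⟩
    exact hw.ne (Subsingleton.elim v w)
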